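/- Let $R,T,S\subseteq \mathbb{Z}_n$ with $R=-R$, $T=-T$ and $0\notin R\cup T$. The bicirculant graph $BC(\mathbb{Z}_n;R,T,S)$ has vertex set $\{g_0 : g\in\mathbb{Z}_n\}\sqcup\{g_1 : g\in\mathbb{Z}_n\}$ and edges $\{h_0,g_0\}$ with $g-h\in R$, $\{h_1,g_1\}$ with $g-h\in T$, and $\{h_0,g_1\}$ with $g-h\in S$. A rooted spanning forest of a graph is an acyclic subgraph containing all vertices, together with a choice of one root vertex in each of its trees. Fix integers $r,t,s\ge 0$ and integers $1\le \alpha_1<\dots<\alpha_r$, $1\le\beta_1<\dots<\beta_t$, $0\le\gamma_1<\dots<\gamma_s$, not depending on $n$. For $n$ large (so that $\alpha_r,\beta_t<\frac n2$ and $\gamma_s\le n-1$), put $R=\{\pm\alpha_1,\dots,\pm\alpha_r\}$, $T=\{\pm\beta_1,\dots,\pm\beta_t\}$, $S=\{\gamma_1,\dots,\gamma_s\}\subseteq\mathbb{Z}_n$ and $$\Gamma_1=BC(\mathbb{Z}_n;R,T,S),$$ and, for even $n$, $$\Gamma_2=BC(\mathbb{Z}_n;R\cup\{\tfrac n2\},T,S),\quad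 \Gamma_3=BC(\mathbb{Z}_n;R,T\cup\{\tfrac n2\},S),\quad \Gamma_4=BC(\mathbb{Z}_n;R\cup\{\tfrac n2\},T\cup\{\tfrac n2\},S).$$ Let $f_{\Gamma_j}(2n)$ be the number of rooted spanning forests of $\Gamma_j$ (a graph with $2n$ vertices). Let $$\mathcal A(z)=2r+s+1-\sum_{j=1}^r(z^{\alpha_j}+z^{-\alpha_j}),\quad \mathcal B(z)=2t+s+1-\sum_{j=1}^t(z^{\beta_j}+z^{-\beta_j}),\quad \mathcal C(z)=-\sum_{j=1}^s z^{\gamma_j},$$ $$P_1=\mathcal A(z)\mathcal B(z)-\mathcal C(z^{-1})\mathcal C(z),\qquad P_2=(\mathcal A(z)+2)\mathcal B(z)-\mathcal C(z^{-1})\mathcal C(z),$$ $$P_3=\mathcal A(z)(\mathcal B(z)+2)-\mathcal C(z^{-1})\mathcal C(z),\qquad P_4=(\mathcal A(z)+2)(\mathcal B(z)+2)-\mathcal C(z^{-1})\mathcal C(z),$$ and for a nonzero Laurent polynomial $P$ let $M(P)=\exp\left(\int_0^1\log|P(e^{2\pi \mathbf{i} t})|\,dt\right)$ be its Mahler measure.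 Write $f(n)\sim g(n)$ for $\lim f(n)/g(n)=1$. Then 1. $f_{\Gamma_1}(2n)\sim M(P_1)^n$ as $n\to\infty$; 2. $f_{\Gamma_2}(2n)\sim M(P_2P_1)^{n/2}$ as $n\to\infty$ through even $n$; 3. $f_{\Gamma_3}(2n)\sim M(P_3P_1)^{n/2}$ as $n\to\infty$ through even $n$; 4. $f_{\Gamma_4}(2n)\sim M(P_4P_1)^{n/2}$ as $n\to\infty$ through even $n$. -/

import Mathlib

open Filter Topology
open scoped LaurentPolynomial

/-- The bi-Cayley graph `BC(G; R, T, S)` of an additive abelian group `G`: the vertices `g₀` are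
`Sum.inl g`, the vertices `g₁` are `Sum.inr g`, and the edges are the pairs `{h₀, g₀}` with
`g - h ∈ R`, `{h₁, g₁}` with `g - h ∈ T` and `{h₀, g₁}` with `g - h ∈ S`. (`fromRel` passes to
unordered pairs of distinct vertices.) -/
def biCayley {G : Type*} [AddCommGroup G] (R T S : Set G) : SimpleGraph (G ⊕ G) :=
  SimpleGraph.fromRel fun x y =>
    match x, y with
    | Sum.inl h, Sum.inl g => g - h ∈ R
    | Sum.inr h, Sum.inr g => g - h ∈ T
    | Sum.inl h, Sum.inr g => g - h ∈ S
    | Sum.inr _, Sum.inl _ => False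

/-- The pair `(F, ρ)` is a rooted spanning forest of `Γ`: `F` is an acyclic subgraph of `Γ` on all
vertices of `Γ`, and `ρ` is a set of vertices (the roots) which contains exactly one vertex of each
tree (connected component) of `F`. -/
def IsRootedSpanningForest {V : Type*} (Γ : SimpleGraph V) (F : SimpleGraph V) (ρ : Set V) : Prop :=
  F ≤ Γ ∧ F.IsAcyclic ∧ ∀ c : F.ConnectedComponent, ∃! v : V, v ∈ ρ ∧ v ∈ c.supp

/-- The number of rooted spanning forests of a (finite) graph. -/
noncomputable def rootedSpanningForestCount {V : Type*} (Γ : SimpleGraph V) : ℕ :=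
  Nat.card {p : SimpleGraph V × Set V // IsRootedSpanningForest Γ p.1 p.2}

/-- The subset `{±a : a ∈ α}` of `ℤ/n`. -/
def plusMinus (n : ℕ) (α : Finset ℕ) : Set (ZMod n) :=
  {x | ∃ a ∈ α, x = (a : ZMod n) ∨ x = -(a : ZMod n)}

/-- The subset `{c : c ∈ γ}` of `ℤ/n`. -/
def residues (n : ℕ) (γ : Finset ℕ) : Set (ZMod n) :=
  {x | ∃ c ∈ γ, x = (c : ZMod n)}

/-- The subset `{n / 2}` of `ℤ/n`, used for even `n`. -/
def half (n : ℕ) : Set (ZMod n) := {((n / 2 : ℕ) : ZMod n)}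

/-- `Γ₁ = BC(ℤ/n; {±α}, {±β}, {γ})`. -/
def Gamma1 (α β γ : Finset ℕ) (n : ℕ) : SimpleGraph (ZMod n ⊕ ZMod n) :=
  biCayley (plusMinus n α) (plusMinus n β) (residues n γ)

/-- `Γ₂ = BC(ℤ/n; {±α, n/2}, {±β}, {γ})`, for even `n`. -/
def Gamma2 (α β γ : Finset ℕ) (n : ℕ) : SimpleGraph (ZMod n ⊕ ZMod n) :=
  biCayley (plusMinus n α ∪ half n) (plusMinus n β) (residues n γ)

/-- `Γ₃ = BC(ℤ/n; {±α}, {±β, n/2}, {γ})`, for even `n`. -/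
def Gamma3 (α β γ : Finset ℕ) (n : ℕ) : SimpleGraph (ZMod n ⊕ ZMod n) :=
  biCayley (plusMinus n α) (plusMinus n β ∪ half n) (residues n γ)

/-- `Γ₄ = BC(ℤ/n; {±α, n/2}, {±β, n/2}, {γ})`, for even `n`. -/
def Gamma4 (α β γ : Finset ℕ) (n : ℕ) : SimpleGraph (ZMod n ⊕ ZMod n) :=
  biCayley (plusMinus n α ∪ half n) (plusMinus n β ∪ half n) (residues n γ)

/-- The Laurent polynomial `2|α| + s + 1 - ∑_{a ∈ α} (z^a + z^{-a})`. With `s = |γ|`, it is `𝒜(z)`,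
and with `β` in place of `α` it is `ℬ(z)`. -/
noncomputable def circPoly (α : Finset ℕ) (s : ℕ) : ℤ[T;T⁻¹] :=
  LaurentPolynomial.C (2 * (α.card : ℤ) + (s : ℤ) + 1) -
    ∑ a ∈ α, (LaurentPolynomial.T (a : ℤ) + LaurentPolynomial.T (-(a : ℤ)))

/-- The Laurent polynomial `𝒞(z) = -∑_{c ∈ γ} z^c`. -/
noncomputable def spokePoly (γ : Finset ℕ) : ℤ[T;T⁻¹] :=
  -∑ c ∈ γ, LaurentPolynomial.T (c : ℤ)

/-- `P₁(z) = 𝒜(z) ℬ(z) - 𝒞(z⁻¹) 𝒞(z)`. -/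
noncomputable def P1 (α β γ : Finset ℕ) : ℤ[T;T⁻¹] :=
  circPoly α γ.card * circPoly β γ.card
    - LaurentPolynomial.invert (spokePoly γ) * spokePoly γ

/-- `P₂(z) = (𝒜(z) + 2) ℬ(z) - 𝒞(z⁻¹) 𝒞(z)`. -/
noncomputable def P2 (α β γ : Finset ℕ) : ℤ[T;T⁻¹] :=
  (circPoly α γ.card + 2) * circPoly β γ.card
    - LaurentPolynomial.invert (spokePoly γ) * spokePoly γ

/-- `P₃(z) = 𝒜(z) (ℬ(z) + 2) - 𝒞(z⁻¹) 𝒞(z)`. -/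
noncomputable def P3 (α β γ : Finset ℕ) : ℤ[T;T⁻¹] :=
  circPoly α γ.card * (circPoly β γ.card + 2)
    - LaurentPolynomial.invert (spokePoly γ) * spokePoly γ

/-- `P₄(z) = (𝒜(z) + 2) (ℬ(z) + 2) - 𝒞(z⁻¹) 𝒞(z)`. -/
noncomputable def P4 (α β γ : Finset ℕ) : ℤ[T;T⁻¹] :=
  (circPoly α γ.card + 2) * (circPoly β γ.card + 2)
    - LaurentPolynomial.invert (spokePoly γ) * spokePoly γ

/-- The value of an integral Laurent polynomial at the point `e^{2πit}` of the unit circle. -/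
noncomputable def evalCircle (P : ℤ[T;T⁻¹]) (t : ℝ) : ℂ :=
  LaurentPolynomial.eval₂ (Int.castRingHom ℂ)
    (Units.mk0 (Complex.exp (2 * Real.pi * Complex.I * t)) (Complex.exp_ne_zero _)) P

/-- The Mahler measure `exp (∫₀¹ log |P(e^{2πit})| dt)` of a nonzero Laurent polynomial `P`. -/
noncomputable def laurentMahlerMeasure (P : ℤ[T;T⁻¹]) : ℝ :=
  Real.exp (∫ t in (0 : ℝ)..1, Real.log ‖evalCircle P t‖)

/-- Asymptotic equivalence `f(n) ∼ g(n)`, i.e. `f(n) / g(n) → 1`, along the filter `l`. -/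
def AsympEquiv (l : Filter ℕ) (f g : ℕ → ℝ) : Prop :=
  Tendsto (fun n => f n / g n) l (𝓝 1)

/-- The filter of `n → ∞` through even `n`. -/
def atTopEven : Filter ℕ := atTop ⊓ 𝓟 {n | Even n}

/-! By the matrix-forest theorem the rooted spanning forests of a graph with Laplacian `L` number
`det (1 + L)`. Expanding this determinant by rows gives a sum over parent maps, in which acyclic
maps contribute 1 and all others 0 (`det_one_add_lapMatrix`).

For a bicirculant graph, `1 + L` consists of four convolution matrices on `ℤ/n`. The characters
diagonalise all four at once, so the determinant is a product over `j < n` of 2×2 determinants, the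
values of `P₁` at `e^{2πij/n}`. An additional element `n/2` has Fourier coefficient `(-1)^j`: with
`n = 2m`, the even `j` still give `P₁` at the `m`-th roots of 1, and the odd `j` give the shifted
polynomial at the `m`-th roots of -1 (`rootedSpanningForestCount_biCayley_eq_prod`).

On the unit circle `𝒜` and `ℬ` have real part at least `s + 1` while `|𝒞| ≤ s`, so none of these
polynomials vanishes there and `log |P|` is smooth and periodic. Its Riemann sums over `m` equally
spaced nodes differ from `m ∫ log |P|` by `O(1/m)`. Exponentiating gives a ratio tending to exactly
1 (`tendsto_prod_norm_evalCircle_div`). -/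

/-! ### Determinants of parent maps -/

/-- A parent map `c` (with `c v = none` meaning that `v` is a root) is ranked if some height function
strictly decreases along it. -/
def IsRanked {V : Type*} (c : V → Option V) : Prop :=
  ∃ d : V → ℕ, ∀ v w, c v = some w → d w < d v

/-- The matrix whose row `v` is `e_v - e_{c v}`, with `e_none = 0`. -/
def parentMatrix {V : Type*} [DecidableEq V] (K : Type*) [Ring K] (c : V → Option V) :
    Matrix V V K :=
  Matrix.of fun v w => (if v = w then 1 else 0) - if c v = some w then 1 else 0

theorem IsRanked.ne {V : Type*} {c : V → Option V} (h : IsRanked c) {v w : V}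
    (hv : c v = some w) : v ≠ w := by
  obtain ⟨d, hd⟩ := h
  rintro rfl
  exact lt_irrefl _ (hd v v hv)

/-- Grouping vertices by height makes the matrix block triangular. No vertex has a parent of its own
height, so every diagonal block is the identity. -/
theorem det_parentMatrix_of_isRanked {V : Type*} [DecidableEq V] [Fintype V] (K : Type*)
    [CommRing K] {c : V → Option V} (h : IsRanked c) : (parentMatrix K c).det = 1 := by
  have hne := fun v w => h.ne (v := v) (w := w)
  obtain ⟨d, hd⟩ := h
  have hb : (parentMatrix K c).BlockTriangular (fun v => OrderDual.toDual (d v)) := by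
    intro i j hij
    have hij' : d i < d j := hij
    have h1 : i ≠ j := by rintro rfl; exact lt_irrefl _ hij'
    have h2 : c i ≠ some j := fun hc => lt_asymm hij' (hd i j hc)
    simp [parentMatrix, h1, h2]
  rw [hb.det]
  refine Finset.prod_eq_one fun a _ => ?_
  have hone : (parentMatrix K c).toSquareBlock (fun v => OrderDual.toDual (d v)) a = 1 := ?_
  · rw [hone, Matrix.det_one]
  ext i j
  have h2 : c i ≠ some (j : V) := fun hc => by
    have h3 := hd i j hc
    have h4 : OrderDual.toDual (d i) = OrderDual.toDual (d j) := i.2.trans j.2.symm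
    exact lt_irrefl _ (h3.trans_le (le_of_eq (OrderDual.toDual.injective h4)))
  simp [Matrix.toSquareBlock, Matrix.toSquareBlockProp, parentMatrix, h2, Matrix.one_apply,
    Subtype.ext_iff]

/-- The indicator of the vertices whose parent chain never ends is constant along parent links and
vanishes at roots, so it lies in the kernel. It is nonzero because the map is not ranked. -/
theorem det_parentMatrix_of_not_isRanked {V : Type*} [DecidableEq V] [Fintype V] (K : Type*)
    [Field K] {c : V → Option V} (h : ¬ IsRanked c) : (parentMatrix K c).det = 0 := by
  classical
  set f : Option V → Option V := fun o => o.bind c with hf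
  have hstep : ∀ v k, f^[k + 1] (some v) = f^[k] (c v) := fun v k => rfl
  have hZ : ∃ v, ∀ k, f^[k] (some v) ≠ none := by
    by_contra! hcon
    -- If every chain ended, the number of steps until it ends would be a height function.
    refine h ⟨fun v => Nat.find (hcon v), fun v w hvw => ?_⟩
    have h1 := Nat.find_spec (hcon v)
    obtain ⟨k, hk⟩ : ∃ k, Nat.find (hcon v) = k + 1 := by
      refine Nat.exists_eq_succ_of_ne_zero fun h0 => ?_
      rw [h0] at h1
      simp at h1
    rw [hk, hstep, hvw] at h1
    have := Nat.find_min' (hcon w) h1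
    change Nat.find (hcon w) < Nat.find (hcon v)
    omega
  obtain ⟨v₀, hv₀⟩ := hZ
  refine Matrix.exists_mulVec_eq_zero_iff.mp
    ⟨fun v => if ∀ k, f^[k] (some v) ≠ none then 1 else 0, ?_, ?_⟩
  · intro h0
    have := congrFun h0 v₀
    simp only [if_pos hv₀, Pi.zero_apply] at this
    exact one_ne_zero this
  · ext v
    simp only [Matrix.mulVec, dotProduct, parentMatrix, Matrix.of_apply, sub_mul, ite_mul, one_mul,
      zero_mul, Finset.sum_sub_distrib, Finset.sum_ite_eq, Finset.mem_univ, if_true, Pi.zero_apply]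
    rw [sub_eq_zero]
    cases hc : c v with
    | none =>
      have : ¬ ∀ k, f^[k] (some v) ≠ none := fun hk => hk 1 (by simp [hf, hc])
      rw [if_neg this]
      simp
    | some w =>
      simp only [Option.some.injEq, Finset.sum_ite_eq, Finset.mem_univ, if_true]
      refine if_congr ?_ rfl rfl
      constructor
      · intro hk k
        have := hk (k + 1)
        rwa [hstep, hc] at this
      · rintro hk (_ | k)
        · simp
        · rw [hstep, hc]; exact hk k

/-! ### Rooted spanning forests as ranked parent maps -/

/-- The graph whose edges join each vertex to its parent. -/
def parentGraph {V : Type*} (c : V → Option V) : SimpleGraph V :=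
  SimpleGraph.fromRel fun v w => c v = some w

theorem parentGraph_adj_of_isRanked {V : Type*} {c : V → Option V} (h : IsRanked c) {v w : V} :
    (parentGraph c).Adj v w ↔ c v = some w ∨ c w = some v := by
  simp only [parentGraph, SimpleGraph.fromRel_adj]
  refine ⟨fun h => h.2, fun h' => ⟨?_, h'⟩⟩
  rcases h' with h' | h'
  · exact h.ne h'
  · exact (h.ne h').symm

theorem IsRanked.induction {V : Type*} {c : V → Option V} (h : IsRanked c) {p : V → Prop}
    (root : ∀ v, c v = none → p v) (step : ∀ v w, c v = some w → p w → p v) (v : V) : p v := by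
  obtain ⟨d, hd⟩ := h
  induction hn : d v using Nat.strong_induction_on generalizing v with
  | _ n ih =>
    cases hc : c v with
    | none => exact root v hc
    | some w => exact step v w hc (ih _ (hn ▸ hd v w hc) w rfl)

theorem IsRanked.exists_root {V : Type*} {c : V → Option V} (h : IsRanked c) (v : V) :
    ∃ r, c r = none ∧ (parentGraph c).Reachable v r := by
  induction v using h.induction with
  | root v hv => exact ⟨v, hv, .refl v⟩
  | step v w hvw ih =>
    obtain ⟨r, hr, hwr⟩ := ih
    exact ⟨r, hr, ((parentGraph_adj_of_isRanked h).2 (.inl hvw)).reachable.trans hwr⟩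

theorem SimpleGraph.Reachable.mem_of_closed {V : Type*} {F : SimpleGraph V} {s : Set V}
    (hs : ∀ v w, F.Adj v w → v ∈ s → w ∈ s) {v w : V} (h : F.Reachable v w) (hv : v ∈ s) :
    w ∈ s := by
  obtain ⟨p⟩ := h
  induction p with
  | nil => exact hv
  | cons hadj _ ih => exact ih (hs _ _ hadj hv)

/-- The vertex `v` is an ancestor of `x` (or `x` itself) under the parent map `c`. -/
def IsAncestor {V : Type*} (c : V → Option V) (v x : V) : Prop :=
  Relation.ReflTransGen (fun a b => c a = some b) x v

theorem IsRanked.isAncestor_le {V : Type*} {c : V → Option V} {d : V → ℕ}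
    (hd : ∀ v w, c v = some w → d w < d v) {v x : V} (h : IsAncestor c v x) : d v ≤ d x := by
  induction h with
  | refl => rfl
  | tail _ h ih => exact (hd _ _ h).le.trans ih

theorem isAncestor_parent {V : Type*} {c : V → Option V} {v x y : V} (h : IsAncestor c v x)
    (hx : c x = some y) (hne : x ≠ v) : IsAncestor c v y := by
  rcases Relation.ReflTransGen.cases_head h with h | ⟨z, hz, h⟩
  · exact absurd h hne
  · rw [hx] at hz
    cases hz
    exact h

/-- Every edge is a bridge: once the edge from `v` to its parent is deleted, the descendants of `v`
are closed under adjacency, and the parent, being of smaller height, is not among them. -/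
theorem IsRanked.isAcyclic_parentGraph {V : Type*} {c : V → Option V} (h : IsRanked c) :
    (parentGraph c).IsAcyclic := by
  rw [SimpleGraph.isAcyclic_iff_forall_adj_isBridge]
  have key : ∀ v w, c v = some w → (parentGraph c).IsBridge s(v, w) := by
    intro v w hvw
    rw [SimpleGraph.isBridge_iff]
    intro hr
    have : w ∈ {x | IsAncestor c v x} := by
      refine hr.mem_of_closed ?_ Relation.ReflTransGen.refl
      intro x y hxy hx
      rw [SimpleGraph.deleteEdges_adj, parentGraph_adj_of_isRanked h] at hxy
      rcases hxy with ⟨hxy | hyx, hne⟩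
      · refine isAncestor_parent hx hxy ?_
        rintro rfl
        rw [hvw] at hxy
        cases hxy
        exact hne rfl
      · exact Relation.ReflTransGen.head hyx hx
    obtain ⟨d, hd⟩ := h
    exact absurd (IsRanked.isAncestor_le hd this) (not_le.2 (hd _ _ hvw))
  intro v w hvw
  rcases (parentGraph_adj_of_isRanked h).1 hvw with h' | h'
  · exact key v w h'
  · rw [Sym2.eq_swap]
    exact key w v h'

/-- The descendants of a root are closed under adjacency, and the only root among them is that root
itself. -/
theorem IsRanked.root_unique {V : Type*} {c : V → Option V} (h : IsRanked c) {r r' : V}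
    (hr : c r = none) (hr' : c r' = none) (hrr : (parentGraph c).Reachable r r') : r = r' := by
  have : r' ∈ {x | IsAncestor c r x} := by
    refine hrr.mem_of_closed ?_ Relation.ReflTransGen.refl
    intro x y hxy hx
    rcases (parentGraph_adj_of_isRanked h).1 hxy with hxy | hyx
    · refine isAncestor_parent hx hxy ?_
      rintro rfl
      rw [hr] at hxy
      cases hxy
    · exact Relation.ReflTransGen.head hyx hx
  rcases Relation.ReflTransGen.cases_head this with h | ⟨z, hz, _⟩
  · exact h.symm
  · rw [hr'] at hz
    cases hz

theorem IsRanked.isRootedSpanningForest {V : Type*} {Γ : SimpleGraph V} {c : V → Option V}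
    (h : IsRanked c) (hΓ : ∀ v w, c v = some w → Γ.Adj v w) :
    IsRootedSpanningForest Γ (parentGraph c) {v | c v = none} := by
  refine ⟨fun v w hvw => ?_, h.isAcyclic_parentGraph, fun C => ?_⟩
  · rcases (parentGraph_adj_of_isRanked h).1 hvw with h' | h'
    · exact hΓ _ _ h'
    · exact (hΓ _ _ h').symm
  · induction C using SimpleGraph.ConnectedComponent.ind with | _ v => ?_
    obtain ⟨r, hr, hvr⟩ := h.exists_root v
    refine ⟨r, ⟨hr, ?_⟩, ?_⟩
    · simpa [SimpleGraph.ConnectedComponent.mem_supp_iff] using hvr.symm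
    · rintro r' ⟨hr', hvr'⟩
      have h2 : (parentGraph c).Reachable r' v := by
        simpa [SimpleGraph.ConnectedComponent.mem_supp_iff] using hvr'
      exact h.root_unique hr' hr (h2.trans hvr)

theorem parentGraph_injective {V : Type*} {c c' : V → Option V} (h : IsRanked c)
    (h' : IsRanked c') (hF : parentGraph c = parentGraph c')
    (hρ : {v | c v = none} = {v | c' v = none}) : c = c' := by
  have hroot : ∀ v, c v = none ↔ c' v = none := fun v => Set.ext_iff.1 hρ v
  funext v
  induction v using h.induction with
  | root v hv => rw [hv, (hroot v).1 hv]
  | step v w hvw ih =>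
    have hadj := (parentGraph_adj_of_isRanked h).2 (.inl hvw)
    rw [hF, parentGraph_adj_of_isRanked h'] at hadj
    rcases hadj with hadj | hadj
    · rw [hvw, hadj]
    -- If `c'` orients the edge the other way, the induction hypothesis at `w` makes `v` and `w`
    -- each other's parent under `c`, against the height.
    · rw [hadj] at ih
      obtain ⟨d, hd⟩ := h
      exact absurd (hd _ _ ih) (hd _ _ hvw).asymm

theorem SimpleGraph.Reachable.exists_adj_dist_lt {V : Type*} {F : SimpleGraph V} {v r : V}
    (h : F.Reachable v r) (hne : v ≠ r) : ∃ w, F.Adj v w ∧ F.dist w r < F.dist v r := by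
  obtain ⟨p, hp⟩ := h.exists_walk_length_eq_dist
  cases p with
  | nil => exact absurd rfl hne
  | cons hadj q =>
    rw [← hp, SimpleGraph.Walk.length_cons]
    exact ⟨_, hadj, Nat.lt_succ_of_le (SimpleGraph.dist_le q)⟩

/-- The parent of a non-root is its neighbour on a shortest path to the root of its tree; the
distance to the root is the height. -/
theorem IsRootedSpanningForest.exists_parent {V : Type*} {Γ F : SimpleGraph V} {ρ : Set V}
    (h : IsRootedSpanningForest Γ F ρ) : ∃ c : V → Option V, IsRanked c ∧
      (∀ v w, c v = some w → Γ.Adj v w) ∧ parentGraph c = F ∧ {v | c v = none} = ρ := by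
  classical
  obtain ⟨hF, hac, hρ⟩ := h
  choose root hroot huniq using fun v => hρ (F.connectedComponentMk v)
  have hreach : ∀ v, F.Reachable v (root v) := fun v => by
    simpa [SimpleGraph.ConnectedComponent.mem_supp_iff, SimpleGraph.reachable_comm] using
      (hroot v).2
  have hrootρ : ∀ v, root v ∈ ρ := fun v => (hroot v).1
  have huniq' : ∀ v r, r ∈ ρ → F.Reachable r v → r = root v := fun v r hr hrv =>
    huniq v r ⟨hr, by simpa [SimpleGraph.ConnectedComponent.mem_supp_iff] using hrv⟩
  have hnext : ∀ v, v ∉ ρ → ∃ w, F.Adj v w ∧ F.dist w (root w) < F.dist v (root v) := by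
    intro v hv
    have hne : v ≠ root v := fun e => hv (e ▸ hrootρ v)
    obtain ⟨w, hadj, hlt⟩ := (hreach v).exists_adj_dist_lt hne
    refine ⟨w, hadj, ?_⟩
    rwa [← huniq' w _ (hrootρ v) ((hreach v).symm.trans hadj.reachable)]
  choose! next hadj hdist using hnext
  set c : V → Option V := fun v => if v ∈ ρ then none else some (next v) with hc
  have hcs : ∀ v w, c v = some w → v ∉ ρ ∧ next v = w := by
    intro v w hvw
    by_cases hv : v ∈ ρ <;> simp_all
  have hrank : IsRanked c := ⟨fun v => F.dist v (root v), fun v w hvw => by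
    obtain ⟨hv, rfl⟩ := hcs v w hvw
    exact hdist v hv⟩
  have hcF : ∀ v w, c v = some w → F.Adj v w := fun v w hvw => by
    obtain ⟨hv, rfl⟩ := hcs v w hvw
    exact hadj v hv
  have hle : parentGraph c ≤ F := fun v w hvw => by
    rcases (parentGraph_adj_of_isRanked hrank).1 hvw with h | h
    · exact hcF _ _ h
    · exact (hcF _ _ h).symm
  have hnone : {v | c v = none} = ρ := by
    ext v
    by_cases hv : v ∈ ρ <;> simp [hc, hv]
  refine ⟨c, hrank, fun v w hvw => hF (hcF v w hvw), le_antisymm hle fun v w hvw => ?_, hnone⟩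
  -- An edge of `F` missed by the parent graph would still be a bridge of `F`, yet its ends are
  -- joined inside the parent graph through their common root.
  by_contra hnot
  have hbr := SimpleGraph.isAcyclic_iff_forall_adj_isBridge.1 hac hvw
  rw [SimpleGraph.isBridge_iff] at hbr
  refine hbr (SimpleGraph.Reachable.mono (G := parentGraph c) ?_ ?_)
  · intro x y hxy
    rw [SimpleGraph.deleteEdges_adj]
    refine ⟨hle hxy, fun hmem => ?_⟩
    rcases Sym2.eq_iff.1 (Set.mem_singleton_iff.1 hmem) with ⟨rfl, rfl⟩ | ⟨rfl, rfl⟩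
    · exact hnot hxy
    · exact hnot hxy.symm
  · obtain ⟨r, hr, hvr⟩ := hrank.exists_root v
    obtain ⟨r', hr', hwr⟩ := hrank.exists_root w
    have h1 : r ∈ ρ := hnone ▸ hr
    have h2 : r' ∈ ρ := hnone ▸ hr'
    have : r = r' := (huniq' v r h1 (hvr.mono hle).symm).trans
      (huniq' v r' h2 ((hwr.mono hle).symm.trans hvw.symm.reachable)).symm
    exact hvr.trans (this ▸ hwr.symm)

theorem rootedSpanningForestCount_eq_card_parent {V : Type*} (Γ : SimpleGraph V) :
    rootedSpanningForestCount Γ =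
      Nat.card {c : V → Option V // IsRanked c ∧ ∀ v w, c v = some w → Γ.Adj v w} := by
  symm
  refine Nat.card_congr (Equiv.ofBijective (fun c => ⟨(parentGraph c.1, {v | c.1 v = none}),
    c.2.1.isRootedSpanningForest c.2.2⟩) ⟨fun c c' h => ?_, fun p => ?_⟩)
  · have h1 := congrArg Subtype.val h
    exact Subtype.ext (parentGraph_injective c.2.1 c'.2.1 (congrArg Prod.fst h1)
      (congrArg Prod.snd h1))
  · obtain ⟨c, hc, hΓ, hF, hρ⟩ := p.2.exists_parent
    exact ⟨⟨c, hc, hΓ⟩, Subtype.ext (Prod.ext hF hρ)⟩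

/-! ### Matrix-forest theorem -/

/-- The matrix-forest theorem. -/
theorem det_one_add_lapMatrix {V : Type*} [Fintype V] [DecidableEq V] (K : Type*) [Field K]
    (Γ : SimpleGraph V) [DecidableRel Γ.Adj] :
    (1 + Γ.lapMatrix K).det = (rootedSpanningForestCount Γ : K) := by
  classical
  -- Row `v` of `1 + L` is `e_v` plus the sum of `e_v - e_w` over neighbours `w`. Choosing one
  -- summand per row is choosing a parent map, with `none` for `e_v`.
  let g : V → Option V → V → K := fun v o => o.elim (Pi.single v 1)
    fun w => if Γ.Adj v w then Pi.single v 1 - Pi.single w 1 else 0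
  have hM : (1 + Γ.lapMatrix K) = fun v => ∑ o, g v o := by
    ext v w
    simp only [Matrix.add_apply, SimpleGraph.lapMatrix, Matrix.sub_apply, SimpleGraph.degMatrix,
      SimpleGraph.adjMatrix_apply, Fintype.sum_option, g, Option.elim,
      Finset.sum_apply]
    have h1 : ∀ u, (if Γ.Adj v u then Pi.single v (1 : K) - Pi.single u 1 else 0 : V → K) w =
        (if v = w then (if Γ.Adj v u then 1 else 0) else 0) -
          (if w = u then (if Γ.Adj v u then 1 else 0) else 0) := by
      intro u
      rw [apply_ite (fun x : V → K => x w)]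
      by_cases hu : Γ.Adj v u <;> simp [hu, Pi.single_apply, eq_comm]
    simp only [h1, Finset.sum_sub_distrib, Finset.sum_ite_eq, Finset.mem_univ, if_true]
    by_cases h : v = w
    · subst h
      simp [SimpleGraph.degree_eq_sum_if_adj, Matrix.diagonal]
    · simp [Matrix.diagonal, h, Ne.symm h]
  have hexp : (1 + Γ.lapMatrix K).det = ∑ c : V → Option V, Matrix.det fun v => g v (c v) := by
    rw [hM]
    exact (Matrix.detRowAlternating (R := K) (n := V)).toMultilinearMap.map_sum g
  have hterm : ∀ c : V → Option V, (Matrix.det fun v => g v (c v)) =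
      if IsRanked c ∧ ∀ v w, c v = some w → Γ.Adj v w then 1 else 0 := by
    intro c
    by_cases hΓ : ∀ v w, c v = some w → Γ.Adj v w
    · have : (fun v => g v (c v)) = parentMatrix K c := by
        ext v w
        simp only [g, parentMatrix, Matrix.of_apply]
        cases hc : c v with
        | none => simp [Pi.single_apply, eq_comm]
        | some u => simp [hΓ v u hc, Pi.single_apply, eq_comm]
      rw [this]
      by_cases hr : IsRanked c
      · rw [if_pos ⟨hr, hΓ⟩, det_parentMatrix_of_isRanked K hr]
      · rw [if_neg (fun h => hr h.1), det_parentMatrix_of_not_isRanked K hr]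
    · rw [if_neg (fun h => hΓ h.2)]
      push Not at hΓ
      obtain ⟨v, w, hvw, hn⟩ := hΓ
      refine Matrix.det_eq_zero_of_row_eq_zero v fun j => ?_
      simp [g, hvw, hn]
  rw [hexp, rootedSpanningForestCount_eq_card_parent, Nat.card_eq_fintype_card,
    Fintype.card_subtype]
  simp [hterm]

/-! ### Fourier diagonalisation of the bicirculant Laplacian -/

/-- Placing the two copies of each index side by side turns the matrix into a block diagonal one
with 2×2 blocks. -/
theorem Matrix.det_fromBlocks_diagonal {ι K : Type*} [Fintype ι] [DecidableEq ι] [CommRing K]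
    (a b c d : ι → K) :
    (Matrix.fromBlocks (Matrix.diagonal a) (Matrix.diagonal b) (Matrix.diagonal c)
      (Matrix.diagonal d)).det = ∏ i, (a i * d i - b i * c i) := by
  let e : ι ⊕ ι ≃ Fin 2 × ι :=
    { toFun := Sum.elim (fun i => (0, i)) (fun i => (1, i))
      invFun := fun p => if p.1 = 0 then Sum.inl p.2 else Sum.inr p.2
      left_inv := by rintro (i | i) <;> simp
      right_inv := by rintro ⟨j, i⟩; fin_cases j <;> simp }
  have h : Matrix.fromBlocks (Matrix.diagonal a) (Matrix.diagonal b) (Matrix.diagonal c)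
      (Matrix.diagonal d) =
      (Matrix.blockDiagonal fun i => !![a i, b i; c i, d i]).submatrix e e := by
    ext (i | i) (j | j) <;>
      simp [e, Matrix.blockDiagonal_apply, Matrix.diagonal_apply]
  rw [h, Matrix.det_submatrix_equiv_self, Matrix.det_blockDiagonal]
  simp [Matrix.det_fin_two]

/-- The Fourier coefficient `∑ x, u x ψ(x k)` of a function on `ℤ/n`. -/
noncomputable def zmodFourier {n : ℕ} [NeZero n] (u : ZMod n → ℂ) (k : ZMod n) : ℂ :=
  ∑ x, u x * ZMod.stdAddChar (x * k)

/-- The matrix with entries `u (g - h)`. -/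
def convMatrix {n : ℕ} (u : ZMod n → ℂ) : Matrix (ZMod n) (ZMod n) ℂ :=
  Matrix.of fun h g => u (g - h)

/-- The character table of `ℤ/n`. -/
noncomputable def charTable (n : ℕ) [NeZero n] : Matrix (ZMod n) (ZMod n) ℂ :=
  Matrix.of fun g k => ZMod.stdAddChar (g * k)

/-- Each character is an eigenvector of every convolution matrix, so one change of basis serves all
four blocks. -/
theorem convMatrix_mul_charTable {n : ℕ} [NeZero n] (u : ZMod n → ℂ) :
    convMatrix u * charTable n = charTable n * Matrix.diagonal (zmodFourier u) := by
  ext h k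
  rw [Matrix.mul_diagonal]
  simp only [Matrix.mul_apply, convMatrix, charTable, Matrix.of_apply, zmodFourier, Finset.mul_sum]
  refine Fintype.sum_equiv (Equiv.subRight h) _ _ fun g => ?_
  have : g * k = h * k + (g - h) * k := by ring
  rw [Equiv.subRight_apply, this, AddChar.map_add_eq_mul]
  ring

theorem det_charTable_ne_zero (n : ℕ) [NeZero n] : (charTable n).det ≠ 0 := by
  have h : charTable n * (Matrix.of fun k g => ZMod.stdAddChar (-(k * g))) = (n : ℂ) • 1 := by
    ext i j
    have h1 : ∀ k : ZMod n, ZMod.stdAddChar (i * k) * ZMod.stdAddChar (-(k * j)) =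
        ZMod.stdAddChar (k * (i - j)) := fun k => by
      rw [← AddChar.map_add_eq_mul]; congr 1; ring
    simp only [Matrix.mul_apply, charTable, Matrix.of_apply, h1]
    rw [AddChar.sum_mulShift _ (ZMod.isPrimitive_stdAddChar n)]
    simp [Matrix.one_apply, sub_eq_zero, ZMod.card]
  intro h0
  have h2 := congrArg Matrix.det h
  rw [Matrix.det_mul, h0, zero_mul, Matrix.det_smul, Matrix.det_one, mul_one] at h2
  exact pow_ne_zero _ (Nat.cast_ne_zero.2 (NeZero.ne n)) h2.symm

theorem det_fromBlocks_convMatrix {n : ℕ} [NeZero n] (a b c d : ZMod n → ℂ) :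
    (Matrix.fromBlocks (convMatrix a) (convMatrix b) (convMatrix c) (convMatrix d)).det =
      ∏ k, (zmodFourier a k * zmodFourier d k - zmodFourier b k * zmodFourier c k) := by
  have h : Matrix.fromBlocks (convMatrix a) (convMatrix b) (convMatrix c) (convMatrix d) *
      Matrix.fromBlocks (charTable n) 0 0 (charTable n) =
      Matrix.fromBlocks (charTable n) 0 0 (charTable n) *
      Matrix.fromBlocks (Matrix.diagonal (zmodFourier a)) (Matrix.diagonal (zmodFourier b))
        (Matrix.diagonal (zmodFourier c)) (Matrix.diagonal (zmodFourier d)) := by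
    simp [Matrix.fromBlocks_multiply, convMatrix_mul_charTable]
  have h2 := congrArg Matrix.det h
  rw [Matrix.det_mul, Matrix.det_mul, mul_comm, Matrix.det_fromBlocks_diagonal] at h2
  refine mul_left_cancel₀ ?_ h2
  rw [Matrix.det_fromBlocks_zero₂₁]
  exact mul_ne_zero (det_charTable_ne_zero n) (det_charTable_ne_zero n)

open Classical in
/-- The number of rooted spanning forests of a bicirculant graph, where `u`, `v`, `w` are the
indicator functions of `R`, `T`, `S`. -/
theorem rootedSpanningForestCount_biCayley {n : ℕ} [NeZero n] {R T S : Set (ZMod n)}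
    (hR : ∀ x ∈ R, -x ∈ R) (hT : ∀ x ∈ T, -x ∈ T) (hR0 : 0 ∉ R) (hT0 : 0 ∉ T)
    {u v w : ZMod n → ℂ} (hu : ∀ x, u x = if x ∈ R then 1 else 0)
    (hv : ∀ x, v x = if x ∈ T then 1 else 0) (hw : ∀ x, w x = if x ∈ S then 1 else 0) :
    (rootedSpanningForestCount (biCayley R T S) : ℂ) =
      ∏ k, ((1 + zmodFourier u 0 + zmodFourier w 0 - zmodFourier u k) *
        (1 + zmodFourier v 0 + zmodFourier w 0 - zmodFourier v k) -
        zmodFourier w k * zmodFourier w (-k)) := by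
  have hself : ∀ {A : Set (ZMod n)}, (∀ x ∈ A, -x ∈ A) → 0 ∉ A → ∀ h g : ZMod n,
      (h ≠ g ∧ (g - h ∈ A ∨ h - g ∈ A)) ↔ g - h ∈ A := by
    intro A hA hA0 h g
    refine ⟨fun ⟨_, hh⟩ => hh.elim id fun hh => by simpa using hA _ hh, fun hh => ⟨?_, .inl hh⟩⟩
    rintro rfl
    exact hA0 (by simpa using hh)
  have ha00 : ∀ h g, (biCayley R T S).Adj (Sum.inl h) (Sum.inl g) ↔ g - h ∈ R := fun h g => by
    simpa [biCayley] using hself hR hR0 h g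
  have ha11 : ∀ h g, (biCayley R T S).Adj (Sum.inr h) (Sum.inr g) ↔ g - h ∈ T := fun h g => by
    simpa [biCayley] using hself hT hT0 h g
  have ha01 : ∀ h g, (biCayley R T S).Adj (Sum.inl h) (Sum.inr g) ↔ g - h ∈ S := fun h g => by
    simp [biCayley]
  have ha10 : ∀ h g, (biCayley R T S).Adj (Sum.inr h) (Sum.inl g) ↔ h - g ∈ S := fun h g => by
    simp [biCayley]
  have hz : ∀ f : ZMod n → ℂ, zmodFourier f 0 = ∑ x, f x := fun f => by simp [zmodFourier]
  have hshift : ∀ (f : ZMod n → ℂ) h, ∑ g, f (g - h) = zmodFourier f 0 := fun f h => by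
    rw [hz]; exact Fintype.sum_equiv (Equiv.subRight h) _ _ fun g => rfl
  have hshift' : ∀ (f : ZMod n → ℂ) h, ∑ g, f (h - g) = zmodFourier f 0 := fun f h => by
    rw [hz]; exact Fintype.sum_equiv (Equiv.subLeft h) _ _ fun g => rfl
  have hdeg0 : ∀ h, ((biCayley R T S).degree (Sum.inl h) : ℂ) =
      zmodFourier u 0 + zmodFourier w 0 := fun h => by
    rw [SimpleGraph.degree_eq_sum_if_adj, Fintype.sum_sum_type, ← hshift u h, ← hshift w h]
    simp only [ha00, ha01, hu, hw]
  have hdeg1 : ∀ h, ((biCayley R T S).degree (Sum.inr h) : ℂ) =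
      zmodFourier v 0 + zmodFourier w 0 := fun h => by
    rw [SimpleGraph.degree_eq_sum_if_adj, Fintype.sum_sum_type, ← hshift v h, ← hshift' w h,
      add_comm]
    simp only [ha11, ha10, hv, hw]
  -- The spokes are seen from the second copy with reversed sign; this reflection of `w` becomes the
  -- Fourier coefficient at `-k`.
  have hmat : 1 + (biCayley R T S).lapMatrix ℂ = Matrix.fromBlocks
      (convMatrix fun x => (if x = 0 then 1 + zmodFourier u 0 + zmodFourier w 0 else 0) - u x)
      (convMatrix fun x => -w x) (convMatrix fun x => -w (-x))
      (convMatrix fun x => (if x = 0 then 1 + zmodFourier v 0 + zmodFourier w 0 else 0) - v x) := by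
    ext (h | h) (g | g)
    · by_cases hgh : h = g
      · subst hgh
        simp [SimpleGraph.lapMatrix, SimpleGraph.degMatrix, convMatrix, hdeg0, hu, hR0, add_assoc]
      · simp [SimpleGraph.lapMatrix, SimpleGraph.degMatrix, convMatrix, hu, ha00, hgh, sub_eq_zero,
          Ne.symm hgh]
    · simp [SimpleGraph.lapMatrix, SimpleGraph.degMatrix, convMatrix, hw, ha01]
    · simp [SimpleGraph.lapMatrix, SimpleGraph.degMatrix, convMatrix, hw, ha10]
    · by_cases hgh : h = g
      · subst hgh
        simp [SimpleGraph.lapMatrix, SimpleGraph.degMatrix, convMatrix, hdeg1, hv, hT0, add_assoc]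
      · simp [SimpleGraph.lapMatrix, SimpleGraph.degMatrix, convMatrix, hv, ha11, hgh, sub_eq_zero,
          Ne.symm hgh]
  have hfd : ∀ (f : ZMod n → ℂ) (a : ℂ) k,
      zmodFourier (fun x => (if x = 0 then a else 0) - f x) k = a - zmodFourier f k := by
    intro f a k
    simp [zmodFourier, sub_mul, Finset.sum_sub_distrib]
  have hfn : ∀ k, zmodFourier (fun x => -w (-x)) k = -zmodFourier w (-k) := by
    intro k
    simp only [zmodFourier, neg_mul, Finset.sum_neg_distrib, neg_inj]
    refine Fintype.sum_equiv (Equiv.neg _) _ _ fun x => ?_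
    simp
  have hfm : ∀ k, zmodFourier (fun x => -w x) k = -zmodFourier w k := by
    intro k
    simp [zmodFourier]
  rw [← det_one_add_lapMatrix ℂ, hmat, det_fromBlocks_convMatrix]
  refine Finset.prod_congr rfl fun k _ => ?_
  rw [hfd, hfd, hfn, hfm, neg_mul_neg]

theorem ZMod.prod_eq_prod_range {n : ℕ} [NeZero n] {M : Type*} [CommMonoid M] (f : ZMod n → M) :
    ∏ k, f k = ∏ j ∈ Finset.range n, f (j : ZMod n) := by
  refine Finset.prod_nbij' (fun k => k.val) (fun j => (j : ZMod n)) ?_ ?_ ?_ ?_ ?_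
  · intro k _; exact Finset.mem_range.2 (ZMod.val_lt k)
  · intro j _; exact Finset.mem_univ _
  · intro k _; simp
  · intro j hj; exact ZMod.val_cast_of_lt (Finset.mem_range.1 hj)
  · intro k _; simp

theorem Finset.prod_range_two_mul {M : Type*} [CommMonoid M] (f : ℕ → M) (m : ℕ) :
    ∏ j ∈ Finset.range (2 * m), f j = ∏ j ∈ Finset.range m, (f (2 * j) * f (2 * j + 1)) := by
  induction m with
  | zero => simp
  | succ m ih => rw [show 2 * (m + 1) = 2 * m + 1 + 1 by ring, Finset.prod_range_succ,
      Finset.prod_range_succ, Finset.prod_range_succ _ m, ih, mul_assoc]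

/-! ### Riemann sums of periodic functions -/

/-- For a periodic `C²` function, shifted Riemann sums converge to the integral faster than the
mesh size. -/
theorem tendsto_sum_sub_mul_integral_of_periodic {g : ℝ → ℝ} (hg : ContDiff ℝ 2 g)
    (hper : Function.Periodic g 1) (θ : ℝ) :
    Tendsto (fun m : ℕ => ∑ j ∈ Finset.range m, g ((j + θ) / m) - m * ∫ t in (0 : ℝ)..1, g t)
      atTop (𝓝 0) := by
  have hcont : Continuous (iteratedDeriv 2 g) := hg.continuous_iteratedDeriv 2 le_rfl
  have hper2 : Function.Periodic (iteratedDeriv 2 g) 1 := fun x => by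
    have h := congrFun (iteratedDeriv_comp_add_const (n := 2) (f := g) (s := 1)) x
    rw [← h]
    congr 1
    exact funext hper
  obtain ⟨C, hC⟩ := (isCompact_Icc (a := (0 : ℝ)) (b := 1)).exists_bound_of_continuousOn
    hcont.continuousOn
  have hbound : ∀ x, |iteratedDeriv 2 g x| ≤ C := fun x => by
    obtain ⟨y, hy, hxy⟩ := hper2.exists_mem_Ico₀ one_pos x
    rw [hxy]
    exact hC y ⟨hy.1, hy.2.le⟩
  have hC0 : 0 ≤ C := (abs_nonneg _).trans (hbound 0)
  have hmain : ∀ m : ℕ, 0 < m →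
      |∑ j ∈ Finset.range m, g ((j + θ) / m) - m * ∫ t in (0 : ℝ)..1, g t| ≤ C / 12 / m := by
    intro m hm
    have hm' : (0 : ℝ) < m := Nat.cast_pos.2 hm
    set a : ℝ := θ / m
    have hle : a ≤ a + 1 := by linarith
    -- On a full period starting at `θ / m` the two half-weighted endpoints agree, so the
    -- trapezoidal rule is the shifted Riemann sum. Its error `C / (12 m²)` survives multiplication
    -- by `m`.
    have herr := trapezoidal_error_le_of_c2 (f := g) (a := a) (b := a + 1) (ζ := C) (N := m)
      hg.contDiffOn (fun x => by
        by_cases hx : x ∈ Set.uIcc a (a + 1)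
        · rw [iteratedDerivWithin_eq_iteratedDeriv
            (by rw [Set.uIcc_of_le hle]; exact uniqueDiffOn_Icc (by linarith)) hg.contDiffAt hx]
          exact hbound x
        -- Off the interval the derivative within it takes the default value 0.
        · rw [iteratedDerivWithin_succ, derivWithin_zero_of_notMem_closure, abs_zero]
          · exact hC0
          · rwa [Set.uIcc, isClosed_Icc.closure_eq]) hm
    have hint : ∫ t in a..a + 1, g t = ∫ t in (0 : ℝ)..1, g t := by
      simpa using hper.intervalIntegral_add_eq a 0
    have hsum : ∑ j ∈ Finset.range m, g ((j + θ) / m) = m * trapezoidal_integral g m a (a + 1) := by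
      obtain ⟨k, rfl⟩ := Nat.exists_eq_succ_of_ne_zero hm.ne'
      rw [trapezoidal_integral, Finset.sum_range_succ', hper a]
      have h1 : ∀ j : ℕ, g (((j + 1 : ℕ) + θ) / (k.succ : ℕ)) =
          g (a + (j + 1) * (a + 1 - a) / (k.succ : ℕ)) := fun j => by
        congr 1
        simp only [a]
        field_simp
        push_cast
        ring
      simp only [h1]
      rw [← mul_assoc, add_sub_cancel_left, mul_one_div_cancel hm'.ne', one_mul, add_comm]
      simp [a]
    rw [trapezoidal_error, hint] at herr
    rw [hsum, ← mul_sub, abs_mul, abs_of_pos hm']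
    calc (m : ℝ) * _ ≤ m * _ := mul_le_mul_of_nonneg_left herr hm'.le
      _ = C / 12 / m := by
        rw [add_sub_cancel_left]
        field_simp
        simp
  refine squeeze_zero_norm' ?_ (tendsto_const_div_atTop_nhds_zero_nat (C / 12))
  filter_upwards [eventually_gt_atTop 0] with m hm using hmain m hm

/-! ### Laurent polynomials on the unit circle and Mahler measure -/

theorem evalCircle_C_mul_T (a k : ℤ) (t : ℝ) :
    evalCircle (LaurentPolynomial.C a * LaurentPolynomial.T k) t =
      a * Complex.exp (k * (2 * Real.pi * Complex.I * t)) := by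
  simp [evalCircle, Complex.exp_int_mul]

theorem evalCircle_add (P Q : ℤ[T;T⁻¹]) (t : ℝ) :
    evalCircle (P + Q) t = evalCircle P t + evalCircle Q t := map_add _ _ _

theorem evalCircle_mul (P Q : ℤ[T;T⁻¹]) (t : ℝ) :
    evalCircle (P * Q) t = evalCircle P t * evalCircle Q t := map_mul _ _ _

theorem contDiff_evalCircle (P : ℤ[T;T⁻¹]) : ContDiff ℝ 2 (evalCircle P) := by
  induction P using LaurentPolynomial.induction_on' with
  | add p q hp hq => simpa only [funext (evalCircle_add p q)] using hp.add hq
  | C_mul_T n a =>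
    simp only [funext (evalCircle_C_mul_T a n)]
    have : ContDiff ℝ 2 (fun t : ℝ => (t : ℂ)) := Complex.ofRealCLM.contDiff
    fun_prop

theorem periodic_evalCircle (P : ℤ[T;T⁻¹]) : Function.Periodic (evalCircle P) 1 := by
  intro t
  have h : Complex.exp (2 * Real.pi * Complex.I * (t + 1 : ℝ)) =
      Complex.exp (2 * Real.pi * Complex.I * t) := by
    rw [Complex.ofReal_add, Complex.ofReal_one, mul_add, mul_one, Complex.exp_periodic]
  simp only [evalCircle, h]

theorem contDiff_log_norm_evalCircle {P : ℤ[T;T⁻¹]} (hP : ∀ t, evalCircle P t ≠ 0) :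
    ContDiff ℝ 2 fun t => Real.log ‖evalCircle P t‖ :=
  ((contDiff_evalCircle P).norm ℝ hP).log fun t => norm_ne_zero_iff.2 (hP t)

theorem laurentMahlerMeasure_mul {P Q : ℤ[T;T⁻¹]} (hP : ∀ t, evalCircle P t ≠ 0)
    (hQ : ∀ t, evalCircle Q t ≠ 0) :
    laurentMahlerMeasure (P * Q) = laurentMahlerMeasure P * laurentMahlerMeasure Q := by
  rw [laurentMahlerMeasure, laurentMahlerMeasure, laurentMahlerMeasure, ← Real.exp_add,
    ← intervalIntegral.integral_add
      ((contDiff_log_norm_evalCircle hP).continuous.intervalIntegrable _ _)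
      ((contDiff_log_norm_evalCircle hQ).continuous.intervalIntegrable _ _)]
  congr 2
  funext t
  rw [evalCircle_mul, norm_mul,
    Real.log_mul (norm_ne_zero_iff.2 (hP t)) (norm_ne_zero_iff.2 (hQ t))]

/-- The product of the values of `P` at the `m`-th roots of `e^{2πiθ}` is asymptotic to the `m`-th
power of the Mahler measure of `P`, if `P` has no zeros on the unit circle. -/
theorem tendsto_prod_norm_evalCircle_div {P : ℤ[T;T⁻¹]} (hP : ∀ t, evalCircle P t ≠ 0) (θ : ℝ) :
    Tendsto (fun m : ℕ => (∏ j ∈ Finset.range m, ‖evalCircle P ((j + θ) / m)‖) /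
      laurentMahlerMeasure P ^ m) atTop (𝓝 1) := by
  have h := tendsto_sum_sub_mul_integral_of_periodic (contDiff_log_norm_evalCircle hP)
    (fun t => by simp only [periodic_evalCircle P t]) θ
  have h2 := (Real.continuous_exp.tendsto _).comp h
  rw [Real.exp_zero] at h2
  refine h2.congr fun m => ?_
  rw [Function.comp_apply, Real.exp_sub, Real.exp_sum, laurentMahlerMeasure, ← Real.exp_nat_mul]
  congr 1
  exact Finset.prod_congr rfl fun j _ => Real.exp_log (norm_pos_iff.2 (hP _))

theorem evalCircle_T (k : ℤ) (t : ℝ) : evalCircle (LaurentPolynomial.T k) t =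
    Complex.exp (k * (2 * Real.pi * Complex.I * t)) := by
  simpa using evalCircle_C_mul_T 1 k t

theorem evalCircle_circPoly (α : Finset ℕ) (s : ℕ) (t : ℝ) :
    evalCircle (circPoly α s) t = 2 * α.card + s + 1 -
      ∑ a ∈ α, (Complex.exp (a * (2 * Real.pi * Complex.I * t)) +
        Complex.exp (-(a * (2 * Real.pi * Complex.I * t)))) := by
  have h : evalCircle (circPoly α s) t =
      evalCircle (LaurentPolynomial.C (2 * (α.card : ℤ) + (s : ℤ) + 1)) t -
      ∑ a ∈ α, (evalCircle (LaurentPolynomial.T (a : ℤ)) t +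
        evalCircle (LaurentPolynomial.T (-(a : ℤ))) t) := by
    simp only [evalCircle, circPoly, map_sub, map_sum, map_add]
  have hC (c : ℤ) : evalCircle (LaurentPolynomial.C c) t = c := LaurentPolynomial.eval₂_C _ _ c
  rw [h, hC]
  simp [evalCircle_T]

theorem evalCircle_spokePoly (γ : Finset ℕ) (t : ℝ) : evalCircle (spokePoly γ) t =
    -∑ c ∈ γ, Complex.exp (c * (2 * Real.pi * Complex.I * t)) := by
  have h : evalCircle (spokePoly γ) t = -∑ c ∈ γ, evalCircle (LaurentPolynomial.T (c : ℤ)) t := by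
    simp only [evalCircle, spokePoly, map_neg, map_sum]
  simp [h, evalCircle_T]

theorem evalCircle_invert_spokePoly (γ : Finset ℕ) (t : ℝ) :
    evalCircle (LaurentPolynomial.invert (spokePoly γ)) t =
    -∑ c ∈ γ, Complex.exp (-(c * (2 * Real.pi * Complex.I * t))) := by
  have h : evalCircle (LaurentPolynomial.invert (spokePoly γ)) t =
      -∑ c ∈ γ, evalCircle (LaurentPolynomial.T (-(c : ℤ))) t := by
    simp only [evalCircle, spokePoly, map_neg, map_sum, LaurentPolynomial.invert_T]
  simp [h, evalCircle_T]

theorem norm_exp_mul_two_pi_I (a t : ℝ) :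
    ‖Complex.exp (a * (2 * Real.pi * Complex.I * t))‖ = 1 := by
  rw [show (a : ℂ) * (2 * Real.pi * Complex.I * t) = ((a * (2 * Real.pi * t) : ℝ) : ℂ) * Complex.I
    by push_cast; ring, Complex.norm_exp_ofReal_mul_I]

theorem le_re_evalCircle_circPoly (α : Finset ℕ) (s : ℕ) (t : ℝ) :
    (s : ℝ) + 1 ≤ (evalCircle (circPoly α s) t).re := by
  have h : (∑ a ∈ α, (Complex.exp (a * (2 * Real.pi * Complex.I * t)) +
        Complex.exp (-(a * (2 * Real.pi * Complex.I * t))))).re ≤ 2 * α.card := by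
    rw [Complex.re_sum]
    refine (Finset.sum_le_card_nsmul _ _ 2 fun a _ => ?_).trans_eq (by simp [mul_comm])
    have h1 := norm_exp_mul_two_pi_I a t
    have h2 := norm_exp_mul_two_pi_I (-a) t
    push_cast at h1 h2
    rw [neg_mul] at h2
    rw [Complex.add_re]
    linarith [Complex.re_le_norm (Complex.exp (a * (2 * Real.pi * Complex.I * t))),
      Complex.re_le_norm (Complex.exp (-(a * (2 * Real.pi * Complex.I * t))))]
  rw [evalCircle_circPoly, Complex.sub_re]
  have h3 : ((2 : ℂ) * α.card + s + 1).re = 2 * α.card + s + 1 := by simp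
  rw [h3]
  linarith

theorem norm_evalCircle_spokePoly_le (γ : Finset ℕ) (t : ℝ) :
    ‖evalCircle (spokePoly γ) t‖ ≤ γ.card := by
  rw [evalCircle_spokePoly, norm_neg]
  refine (norm_sum_le _ _).trans_eq ?_
  have h (c : ℕ) := norm_exp_mul_two_pi_I c t
  push_cast at h
  simp [h]

theorem norm_evalCircle_invert_spokePoly_le (γ : Finset ℕ) (t : ℝ) :
    ‖evalCircle (LaurentPolynomial.invert (spokePoly γ)) t‖ ≤ γ.card := by
  rw [evalCircle_invert_spokePoly, norm_neg]
  refine (norm_sum_le _ _).trans_eq ?_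
  have h (c : ℕ) := norm_exp_mul_two_pi_I (-c) t
  push_cast at h
  simp only [neg_mul] at h
  simp [h]

/-- Here `|ab| ≥ (s + 1)² > s² ≥ |cd|`. The gap of 1 is the identity added to the Laplacian, and
bounding real parts lets the bound survive adding `p, q ≥ 0`. -/
theorem mul_sub_mul_ne_zero_of_le_re {a b c d : ℂ} {s : ℝ} (ha : s + 1 ≤ a.re) (hb : s + 1 ≤ b.re)
    (hc : ‖c‖ ≤ s) (hd : ‖d‖ ≤ s) : a * b - c * d ≠ 0 := by
  intro h
  have hs : 0 ≤ s := (norm_nonneg _).trans hc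
  have h1 : ‖a‖ * ‖b‖ = ‖c‖ * ‖d‖ := by rw [← norm_mul, ← norm_mul, sub_eq_zero.1 h]
  have h2 : (s + 1) * (s + 1) ≤ ‖a‖ * ‖b‖ := mul_le_mul (ha.trans (Complex.re_le_norm a))
    (hb.trans (Complex.re_le_norm b)) (by linarith) (norm_nonneg _)
  have h3 : ‖c‖ * ‖d‖ ≤ s * s := mul_le_mul hc hd (norm_nonneg _) hs
  nlinarith

/-- The polynomial `(𝒜(z) + p) (ℬ(z) + q) - 𝒞(z⁻¹) 𝒞(z)`. -/
noncomputable def shiftedPoly (α β γ : Finset ℕ) (p q : ℕ) : ℤ[T;T⁻¹] :=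
  (circPoly α γ.card + p) * (circPoly β γ.card + q)
    - LaurentPolynomial.invert (spokePoly γ) * spokePoly γ

theorem evalCircle_shiftedPoly (α β γ : Finset ℕ) (p q : ℕ) (t : ℝ) :
    evalCircle (shiftedPoly α β γ p q) t =
      (evalCircle (circPoly α γ.card) t + p) * (evalCircle (circPoly β γ.card) t + q) -
        evalCircle (LaurentPolynomial.invert (spokePoly γ)) t * evalCircle (spokePoly γ) t := by
  simp only [evalCircle, shiftedPoly, map_sub, map_mul, map_add, map_natCast]

theorem evalCircle_shiftedPoly_ne_zero (α β γ : Finset ℕ) (p q : ℕ) (t : ℝ) :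
    evalCircle (shiftedPoly α β γ p q) t ≠ 0 := by
  rw [evalCircle_shiftedPoly]
  refine mul_sub_mul_ne_zero_of_le_re (s := γ.card) ?_ ?_
    (norm_evalCircle_invert_spokePoly_le γ t) (norm_evalCircle_spokePoly_le γ t)
  · rw [Complex.add_re, Complex.natCast_re]
    linarith [le_re_evalCircle_circPoly α γ.card t, p.cast_nonneg (α := ℝ)]
  · rw [Complex.add_re, Complex.natCast_re]
    linarith [le_re_evalCircle_circPoly β γ.card t, q.cast_nonneg (α := ℝ)]

/-! ### Fourier coefficients of the connection sets -/

theorem stdAddChar_natCast_mul_natCast {n : ℕ} [NeZero n] (a j : ℕ) :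
    ZMod.stdAddChar ((a : ZMod n) * (j : ZMod n)) =
      Complex.exp (a * (2 * Real.pi * Complex.I * ((j / n : ℝ) : ℂ))) := by
  have h := ZMod.stdAddChar_coe (N := n) ((a * j : ℕ) : ℤ)
  push_cast at h
  rw [h]
  congr 1
  push_cast
  ring

theorem stdAddChar_neg_natCast_mul_natCast {n : ℕ} [NeZero n] (a j : ℕ) :
    ZMod.stdAddChar (-((a : ZMod n) * (j : ZMod n))) =
      Complex.exp (-(a * (2 * Real.pi * Complex.I * ((j / n : ℝ) : ℂ)))) := by
  rw [AddChar.map_neg_eq_inv, stdAddChar_natCast_mul_natCast, Complex.exp_neg]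

/-- The function counting the representations of a residue as `±a` with `a ∈ α`. -/
noncomputable def circInd (n : ℕ) (α : Finset ℕ) (x : ZMod n) : ℂ :=
  ∑ a ∈ α, ((if x = (a : ZMod n) then 1 else 0) + if x = -(a : ZMod n) then 1 else 0)

/-- The indicator function of `half n`. -/
noncomputable def halfInd (n : ℕ) (x : ZMod n) : ℂ := if x = ((n / 2 : ℕ) : ZMod n) then 1 else 0

/-- The function counting the representations of a residue as `c` with `c ∈ γ`. -/
noncomputable def spokeInd (n : ℕ) (γ : Finset ℕ) (x : ZMod n) : ℂ :=
  ∑ c ∈ γ, if x = (c : ZMod n) then 1 else 0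

theorem zmodFourier_circInd {n : ℕ} [NeZero n] (α : Finset ℕ) (k : ZMod n) :
    zmodFourier (circInd n α) k =
      ∑ a ∈ α, (ZMod.stdAddChar ((a : ZMod n) * k) + ZMod.stdAddChar (-((a : ZMod n) * k))) := by
  simp only [zmodFourier, circInd, Finset.sum_mul]
  rw [Finset.sum_comm]
  simp [add_mul, Finset.sum_add_distrib]

theorem zmodFourier_spokeInd {n : ℕ} [NeZero n] (γ : Finset ℕ) (k : ZMod n) :
    zmodFourier (spokeInd n γ) k = ∑ c ∈ γ, ZMod.stdAddChar ((c : ZMod n) * k) := by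
  simp only [zmodFourier, spokeInd, Finset.sum_mul]
  rw [Finset.sum_comm]
  simp

theorem zmodFourier_halfInd {n : ℕ} [NeZero n] (k : ZMod n) :
    zmodFourier (halfInd n) k = ZMod.stdAddChar (((n / 2 : ℕ) : ZMod n) * k) := by
  simp [zmodFourier, halfInd]

/-- The character value is `e^{2πi m j / (2m)} = e^{πij}`; this sign separates even from odd
frequencies. -/
theorem zmodFourier_halfInd_two_mul {m : ℕ} [NeZero (2 * m)] (j : ℕ) :
    zmodFourier (halfInd (2 * m)) (j : ZMod (2 * m)) = (-1) ^ j := by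
  have hm : (m : ℂ) ≠ 0 := by
    rintro h
    have : m = 0 := by exact_mod_cast h
    exact NeZero.ne (2 * m) (by simp [this])
  rw [zmodFourier_halfInd, stdAddChar_natCast_mul_natCast, ← Complex.exp_pi_mul_I,
    ← Complex.exp_nat_mul]
  congr 1
  rw [Nat.mul_div_cancel_left _ two_pos]
  push_cast
  field_simp

theorem zmodFourier_add_mul {n : ℕ} [NeZero n] (u v : ZMod n → ℂ) (ε : ℂ) (k : ZMod n) :
    zmodFourier (fun x => u x + ε * v x) k = zmodFourier u k + ε * zmodFourier v k := by
  simp [zmodFourier, add_mul, Finset.sum_add_distrib, Finset.mul_sum, mul_assoc]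

open Classical in
/-- `R` is a connection set avoiding `0`, with indicator function `circInd n α + ε * halfInd n`. -/
structure IsCirculantSet (n : ℕ) (α : Finset ℕ) (ε : ℕ) (R : Set (ZMod n)) : Prop where
  neg_mem : ∀ x ∈ R, -x ∈ R
  zero_notMem : 0 ∉ R
  indicator : ∀ x, circInd n α x + ε * halfInd n x = if x ∈ R then 1 else 0

theorem ZMod.natCast_injOn_lt {n a b : ℕ} (ha : a < n) (hb : b < n)
    (h : (a : ZMod n) = (b : ZMod n)) : a = b := by
  rw [ZMod.natCast_eq_natCast_iff'] at h
  rwa [Nat.mod_eq_of_lt ha, Nat.mod_eq_of_lt hb] at h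

theorem ZMod.natCast_ne_neg_natCast {n a b : ℕ} (hpos : 0 < a + b) (hlt : a + b < n) :
    (a : ZMod n) ≠ -(b : ZMod n) := by
  intro h
  rw [eq_neg_iff_add_eq_zero, ← Nat.cast_add, ZMod.natCast_eq_zero_iff] at h
  exact absurd (Nat.le_of_dvd hpos h) (not_le.2 hlt)

theorem neg_mem_plusMinus {n : ℕ} {α : Finset ℕ} {x : ZMod n} (hx : x ∈ plusMinus n α) :
    -x ∈ plusMinus n α := by
  obtain ⟨a, ha, rfl | rfl⟩ := hx
  · exact ⟨a, ha, .inr rfl⟩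
  · exact ⟨a, ha, .inl (neg_neg _)⟩

-- For `2 * a < n` the residues `±a` are pairwise distinct, so nothing is counted twice.
open Classical in
theorem circInd_eq {n : ℕ} {α : Finset ℕ} (hα : ∀ a ∈ α, 1 ≤ a) (hn : ∀ a ∈ α, 2 * a < n)
    (x : ZMod n) : circInd n α x = if x ∈ plusMinus n α then 1 else 0 := by
  have hinj : ∀ a ∈ α, ∀ b ∈ α, (a : ZMod n) = b ↔ a = b := fun a ha b hb =>
    ⟨ZMod.natCast_injOn_lt (by linarith [hn a ha, hα a ha]) (by linarith [hn b hb, hα b hb]),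
      fun h => by rw [h]⟩
  have hne : ∀ a ∈ α, ∀ b ∈ α, (a : ZMod n) ≠ -(b : ZMod n) := fun a ha b hb =>
    ZMod.natCast_ne_neg_natCast (by linarith [hα a ha]) (by linarith [hn a ha, hn b hb])
  split_ifs with hx
  · obtain ⟨a, ha, rfl | rfl⟩ := hx
    · rw [circInd, Finset.sum_congr rfl fun b hb => by rw [if_neg (hne a ha b hb), add_zero,
        if_congr (hinj a ha b hb) rfl rfl]]
      simp [ha]
    · rw [circInd, Finset.sum_congr rfl fun b hb => by rw [if_neg (hne b hb a ha).symm, zero_add,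
        if_congr (neg_inj.trans (hinj a ha b hb)) rfl rfl]]
      simp [ha]
  · refine Finset.sum_eq_zero fun a ha => ?_
    rw [if_neg fun h => hx ⟨a, ha, .inl h⟩, if_neg fun h => hx ⟨a, ha, .inr h⟩, add_zero]

theorem zero_notMem_plusMinus {n : ℕ} {α : Finset ℕ} (hα : ∀ a ∈ α, 1 ≤ a)
    (hn : ∀ a ∈ α, 2 * a < n) : (0 : ZMod n) ∉ plusMinus n α := by
  rintro ⟨a, ha, h⟩
  have h' : ((0 : ℕ) : ZMod n) = a := by simpa [eq_comm] using h
  exact (Nat.lt_of_lt_of_le zero_lt_one (hα a ha)).ne (ZMod.natCast_injOn_lt (by linarith [hn a ha]) (by linarith [hn a ha]) h')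

theorem isCirculantSet_plusMinus {n : ℕ} {α : Finset ℕ} (hα : ∀ a ∈ α, 1 ≤ a)
    (hn : ∀ a ∈ α, 2 * a < n) : IsCirculantSet n α 0 (plusMinus n α) where
  neg_mem _ := neg_mem_plusMinus
  zero_notMem := zero_notMem_plusMinus hα hn
  indicator x := by rw [circInd_eq hα hn]; simp

theorem isCirculantSet_plusMinus_union_half {m : ℕ} {α : Finset ℕ} (hm : 0 < m)
    (hα : ∀ a ∈ α, 1 ≤ a) (hn : ∀ a ∈ α, 2 * a < 2 * m) :
    IsCirculantSet (2 * m) α 1 (plusMinus (2 * m) α ∪ half (2 * m)) := by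
  have hhalf : half (2 * m) = {(m : ZMod (2 * m))} := by
    rw [half, Nat.mul_div_cancel_left _ two_pos]
  have hmem : (m : ZMod (2 * m)) ∉ plusMinus (2 * m) α := by
    rintro ⟨a, ha, h | h⟩
    · have := ZMod.natCast_injOn_lt (by omega) (by linarith [hn a ha, hα a ha]) h
      linarith [hn a ha]
    · exact ZMod.natCast_ne_neg_natCast (by omega) (by linarith [hn a ha]) h
  refine ⟨?_, ?_, fun x => ?_⟩
  · rintro x (hx | hx)
    · exact .inl (neg_mem_plusMinus hx)
    · right
      rw [hhalf, Set.mem_singleton_iff] at hx ⊢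
      rw [hx, neg_eq_iff_add_eq_zero, ← Nat.cast_add, ← two_mul, ZMod.natCast_self]
  · rintro (h | h)
    · exact zero_notMem_plusMinus hα hn h
    · rw [hhalf, Set.mem_singleton_iff, ← Nat.cast_zero] at h
      exact hm.ne (ZMod.natCast_injOn_lt (by omega) (by omega) h)
  · rw [circInd_eq hα hn, halfInd, Nat.mul_div_cancel_left _ two_pos, hhalf]
    by_cases hx : x = (m : ZMod (2 * m))
    · subst hx
      simp [hmem]
    · rw [if_neg hx, mul_zero, add_zero]
      have hiff : x ∈ plusMinus (2 * m) α ∪ {(m : ZMod (2 * m))} ↔ x ∈ plusMinus (2 * m) α := by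
        rw [Set.mem_union, Set.mem_singleton_iff, or_iff_left hx]
      by_cases hmem' : x ∈ plusMinus (2 * m) α
      · rw [if_pos hmem', if_pos (hiff.2 hmem')]
      · rw [if_neg hmem', if_neg (hiff.not.2 hmem')]

open Classical in
theorem spokeInd_eq {n : ℕ} {γ : Finset ℕ} (hn : ∀ c ∈ γ, c < n) (x : ZMod n) :
    spokeInd n γ x = if x ∈ residues n γ then 1 else 0 := by
  split_ifs with hx
  · obtain ⟨a, ha, rfl⟩ := hx
    rw [spokeInd, Finset.sum_congr rfl fun b hb => if_congr
      ⟨ZMod.natCast_injOn_lt (hn a ha) (hn b hb), fun h => by rw [h]⟩ rfl rfl]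
    simp [ha]
  · exact Finset.sum_eq_zero fun a ha => if_neg fun h => hx ⟨a, ha, h⟩

/-! ### Product formula and asymptotics -/

/-- The element `n/2` adds `ε` to the degree and subtracts `ε` times its character value. The
resulting `ε * (1 - χ)`, with `χ = ±1` by parity, is the source of the `+2` in the shifted
polynomials. -/
theorem rootedSpanningForestCount_biCayley_eq_prod {n : ℕ} [NeZero n] {α β γ : Finset ℕ}
    {ε δ : ℕ} {R T : Set (ZMod n)} (hR : IsCirculantSet n α ε R) (hT : IsCirculantSet n β δ T)
    (hγ : ∀ c ∈ γ, c < n) :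
    (rootedSpanningForestCount (biCayley R T (residues n γ)) : ℂ) =
      ∏ j ∈ Finset.range n,
        ((evalCircle (circPoly α γ.card) (j / n) + ε * (1 - zmodFourier (halfInd n) j)) *
          (evalCircle (circPoly β γ.card) (j / n) + δ * (1 - zmodFourier (halfInd n) j)) -
          evalCircle (LaurentPolynomial.invert (spokePoly γ)) (j / n) *
            evalCircle (spokePoly γ) (j / n)) := by
  classical
  have hhalf : zmodFourier (halfInd n) 0 = 1 := by simp [zmodFourier_halfInd]
  have hcirc : ∀ (α : Finset ℕ) (ε : ℕ) (j : ℕ),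
      1 + zmodFourier (fun x => circInd n α x + ε * halfInd n x) 0 + zmodFourier (spokeInd n γ) 0 -
        zmodFourier (fun x => circInd n α x + ε * halfInd n x) j =
      evalCircle (circPoly α γ.card) (j / n) + ε * (1 - zmodFourier (halfInd n) j) := by
    intro α ε j
    rw [zmodFourier_add_mul, zmodFourier_add_mul, hhalf, evalCircle_circPoly, zmodFourier_circInd,
      zmodFourier_circInd, zmodFourier_spokeInd]
    simp only [stdAddChar_natCast_mul_natCast, stdAddChar_neg_natCast_mul_natCast, mul_zero,
      neg_zero, AddChar.map_zero_eq_one, Finset.sum_const, nsmul_eq_mul]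
    ring
  rw [rootedSpanningForestCount_biCayley hR.neg_mem hT.neg_mem hR.zero_notMem hT.zero_notMem
    (fun x => (hR.indicator x).trans (by congr)) (fun x => (hT.indicator x).trans (by congr))
    (fun x => (spokeInd_eq hγ x).trans (by congr)), ZMod.prod_eq_prod_range]
  refine Finset.prod_congr rfl fun j _ => ?_
  rw [hcirc, hcirc, evalCircle_invert_spokePoly, evalCircle_spokePoly, zmodFourier_spokeInd,
    zmodFourier_spokeInd]
  simp only [mul_neg, stdAddChar_natCast_mul_natCast, stdAddChar_neg_natCast_mul_natCast]
  ring

theorem eventually_forall_mem_lt (s : Finset ℕ) (k : ℕ) : ∀ᶠ n : ℕ in atTop, ∀ a ∈ s, k * a < n :=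
  (Finset.eventually_all s).2 fun a _ => eventually_gt_atTop (k * a)

theorem asympEquiv_Gamma1 {α β γ : Finset ℕ} (hα : ∀ a ∈ α, 1 ≤ a) (hβ : ∀ b ∈ β, 1 ≤ b) :
    AsympEquiv atTop (fun n => (rootedSpanningForestCount (Gamma1 α β γ n) : ℝ))
      (fun n => laurentMahlerMeasure (shiftedPoly α β γ 0 0) ^ n) := by
  refine (tendsto_prod_norm_evalCircle_div (evalCircle_shiftedPoly_ne_zero α β γ 0 0) 0).congr' ?_
  filter_upwards [eventually_gt_atTop 0, eventually_forall_mem_lt α 2,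
    eventually_forall_mem_lt β 2, eventually_forall_mem_lt γ 1] with n hn hnα hnβ hnγ
  have : NeZero n := ⟨hn.ne'⟩
  have h := congrArg norm (rootedSpanningForestCount_biCayley_eq_prod
    (isCirculantSet_plusMinus hα hnα) (isCirculantSet_plusMinus hβ hnβ)
    (fun c hc => (one_mul c).symm ▸ hnγ c hc))
  rw [Complex.norm_natCast, norm_prod] at h
  congr 1
  rw [Gamma1, h]
  refine Finset.prod_congr rfl fun j _ => ?_
  rw [evalCircle_shiftedPoly, add_zero]
  simp

theorem tendsto_atTopEven {X : Type*} {F : ℕ → X} {l : Filter X}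
    (h : Tendsto (fun m => F (2 * m)) atTop l) : Tendsto F atTopEven l := by
  have h2 : Tendsto (fun n : ℕ => n / 2) atTopEven atTop :=
    (Nat.tendsto_div_const_atTop two_ne_zero).mono_left inf_le_left
  refine (h.comp h2).congr' ?_
  have : ∀ᶠ n in atTopEven, Even n := mem_inf_of_right (mem_principal_self _)
  filter_upwards [this] with n hn
  rw [Function.comp_apply, Nat.two_mul_div_two_of_even hn]

theorem asympEquiv_biCayley_of_even {α β γ : Finset ℕ} {ε δ : ℕ}
    {R T : (n : ℕ) → Set (ZMod n)} (hR : ∀ᶠ m in atTop, IsCirculantSet (2 * m) α ε (R (2 * m)))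
    (hT : ∀ᶠ m in atTop, IsCirculantSet (2 * m) β δ (T (2 * m))) :
    AsympEquiv atTopEven
      (fun n => (rootedSpanningForestCount (biCayley (R n) (T n) (residues n γ)) : ℝ))
      (fun n => laurentMahlerMeasure
        (shiftedPoly α β γ (2 * ε) (2 * δ) * shiftedPoly α β γ 0 0) ^ ((n : ℝ) / 2)) := by
  have hP := evalCircle_shiftedPoly_ne_zero α β γ 0 0
  have hQ := evalCircle_shiftedPoly_ne_zero α β γ (2 * ε) (2 * δ)
  refine tendsto_atTopEven ?_
  -- Even frequencies `2j` give nodes `j / m`; odd ones `2j + 1` give `(j + 1/2) / m`, hence the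
  -- offset `θ = 1/2` for the shifted polynomial.
  have hlim := (tendsto_prod_norm_evalCircle_div hP 0).mul
    (tendsto_prod_norm_evalCircle_div hQ (1 / 2))
  rw [one_mul] at hlim
  refine hlim.congr' ?_
  filter_upwards [eventually_gt_atTop 0, hR, hT, eventually_forall_mem_lt γ 1]
    with m hm hRm hTm hγ
  have : NeZero (2 * m) := ⟨by omega⟩
  have h := congrArg norm (rootedSpanningForestCount_biCayley_eq_prod hRm hTm
    (fun c hc => by linarith [hγ c hc]))
  rw [Complex.norm_natCast, norm_prod, Finset.prod_range_two_mul, Finset.prod_mul_distrib] at h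
  have hexp : ((2 * m : ℕ) : ℝ) / 2 = (m : ℕ) := by push_cast; ring
  rw [hexp, Real.rpow_natCast, laurentMahlerMeasure_mul hQ hP, mul_pow, h, div_mul_div_comm,
    mul_comm (laurentMahlerMeasure (shiftedPoly α β γ (2 * ε) (2 * δ)) ^ m)]
  congr 2
  · refine Finset.prod_congr rfl fun j _ => ?_
    have hj : ((2 * j : ℕ) : ℝ) / (2 * m : ℕ) = (j + 0) / m := by
      push_cast
      rw [add_zero, mul_div_mul_left _ _ two_ne_zero]
    rw [evalCircle_shiftedPoly, hj, zmodFourier_halfInd_two_mul, pow_mul]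
    simp
  · refine Finset.prod_congr rfl fun j _ => ?_
    have hj : ((2 * j + 1 : ℕ) : ℝ) / (2 * m : ℕ) = (j + 1 / 2) / m := by
      push_cast
      field_simp
    rw [evalCircle_shiftedPoly, hj, zmodFourier_halfInd_two_mul, pow_succ, pow_mul]
    push_cast
    congr 3 <;> ring

theorem eventually_isCirculantSet_plusMinus {α : Finset ℕ} (hα : ∀ a ∈ α, 1 ≤ a) :
    ∀ᶠ m in atTop, IsCirculantSet (2 * m) α 0 (plusMinus (2 * m) α) := by
  -- The modulus is `2 * m`, so `a < m` already gives `2 * a < 2 * m`.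
  filter_upwards [eventually_forall_mem_lt α 1] with m hm
  exact isCirculantSet_plusMinus hα fun a ha => by linarith [hm a ha]

theorem eventually_isCirculantSet_plusMinus_union_half {α : Finset ℕ} (hα : ∀ a ∈ α, 1 ≤ a) :
    ∀ᶠ m in atTop, IsCirculantSet (2 * m) α 1 (plusMinus (2 * m) α ∪ half (2 * m)) := by
  filter_upwards [eventually_gt_atTop 0, eventually_forall_mem_lt α 1] with m hm0 hm
  exact isCirculantSet_plusMinus_union_half hm0 hα fun a ha => by linarith [hm a ha]

theorem theorem5p1 (α β γ : Finset ℕ) (hα : ∀ a ∈ α, 1 ≤ a) (hβ : ∀ b ∈ β, 1 ≤ b) :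
    AsympEquiv atTop (fun n => (rootedSpanningForestCount (Gamma1 α β γ n) : ℝ))
      (fun n => laurentMahlerMeasure (P1 α β γ) ^ n) ∧
    AsympEquiv atTopEven (fun n => (rootedSpanningForestCount (Gamma2 α β γ n) : ℝ))
      (fun n => laurentMahlerMeasure (P2 α β γ * P1 α β γ) ^ ((n : ℝ) / 2)) ∧
    AsympEquiv atTopEven (fun n => (rootedSpanningForestCount (Gamma3 α β γ n) : ℝ))
      (fun n => laurentMahlerMeasure (P3 α β γ * P1 α β γ) ^ ((n : ℝ) / 2)) ∧
    AsympEquiv atTopEven (fun n => (rootedSpanningForestCount (Gamma4 α β γ n) : ℝ))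
      (fun n => laurentMahlerMeasure (P4 α β γ * P1 α β γ) ^ ((n : ℝ) / 2)) := by
  have h1 : P1 α β γ = shiftedPoly α β γ 0 0 := by simp [P1, shiftedPoly]
  -- The shifts are written `2 * ε` and `2 * δ`, with `ε`, `δ` recording whether `n/2` belongs to
  -- `R`, `T`.
  have h2 : P2 α β γ = shiftedPoly α β γ (2 * 1) (2 * 0) := by simp [P2, shiftedPoly]
  have h3 : P3 α β γ = shiftedPoly α β γ (2 * 0) (2 * 1) := by simp [P3, shiftedPoly]
  have h4 : P4 α β γ = shiftedPoly α β γ (2 * 1) (2 * 1) := by simp [P4, shiftedPoly]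
  have hα0 := eventually_isCirculantSet_plusMinus hα
  have hβ0 := eventually_isCirculantSet_plusMinus hβ
  have hα1 := eventually_isCirculantSet_plusMinus_union_half hα
  have hβ1 := eventually_isCirculantSet_plusMinus_union_half hβ
  rw [h1, h2, h3, h4]
  exact ⟨asympEquiv_Gamma1 hα hβ,
    asympEquiv_biCayley_of_even (R := fun n => plusMinus n α ∪ half n) (T := fun n => plusMinus n β)
      hα1 hβ0,
    asympEquiv_biCayley_of_even (R := fun n => plusMinus n α) (T := fun n => plusMinus n β ∪ half n)
      hα0 hβ1,
    asympEquiv_biCayley_of_even (R := fun n => plusMinus n α ∪ half n)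
      (T := fun n => plusMinus n β ∪ half n) hα1 hβ1⟩
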